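/- Let $(M,g)$ be a smooth Riemannian manifold of dimension $n$ (without boundary) with Levi-Civita connection $\nabla^{LC}$. For a differential form $A$ of degree $k\ge 2$ let $A_{\mathfrak o}$ be the $(k-2)$-form with values in the skew endomorphisms of $TM$ given by $$g\big(A_{\mathfrak o}(X_1,\dots,X_{k-2})X_{k-1},X_k\big)=2A(X_1,\dots,X_k),$$ and for an $\mathrm{End}(TM)$-valued $2$-form $A$ let $A^\top$ be given by $g(A^\top(X,Y)W,Z)=g(A(W,Z)X,Y)$. Let $B$ be a smooth real $3$-form on $M$, and let $R$ and $R_-$ be the curvature tensors of the connections $\nabla=\nabla^{LC}+B_{\mathfrak o}$ and $\nabla_-=\nabla^{LC}-B_{\mathfrak o}$ on $TM$, where $R(X,Y)=[\nabla_X,\nabla_Y]-\nabla_{[X,Y]}$. Then $$R^\top=R_-+(dB)_{\mathfrak o}.$$ In particular, if $dB=0$, then $R^\top=R_-$, and the constant term $$\det{}^{1/2}\Big(\frac{tR^\top/2}{\sinh(tR^\top/2)}\Big)$$ of Mehler's formula is, up to powers of $2\pi i t$, the Chern-Weil $\widehat{A}$-form of $\nabla_-$: if $$\widehat A(\nabla_-)=\det{}^{1/2}\Big(\frac{\Omega_-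 /2}{\sinh(\Omega_- /2)}\Big),\qquad \Omega_-=\frac{1}{2\pi i}R_-,$$ then, for every $t$ (with the matrices of $2$-forms $R^\top_{ab}=g(R^\top e_b,e_a)$ and $(R_-)_{ab}=g(R_-e_b,e_a)$ taken in any orthonormal basis of the tangent space), $$\det{}^{1/2}\Big(\frac{tR^\top/2}{\sinh(tR^\top/2)}\Big)=\sum_{j\ge 0}(2\pi i t)^j\,\widehat A(\nabla_-)_{[2j]},$$ where $\alpha_{[2j]}$ is the component of degree $2j$ of the form $\alpha$. -/

import Mathlib

set_option linter.unusedSectionVars false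

open Bundle FiberBundle
open scoped Manifold ContDiff Bundle

noncomputable section
namespace SkewTorsion

/- ### Linear algebra on one tangent space `V` -/

section Pointwise

variable {V : Type*} [NormedAddCommGroup V] [InnerProductSpace ℝ V] [FiniteDimensional ℝ V]

/-- The metric isomorphism `V* → V`: `g(sharp f, Z) = f Z`. -/
def sharp : Module.Dual ℝ V →ₗ[ℝ] V where
  toFun f := (InnerProductSpace.toDual ℝ V).symm (LinearMap.toContinuousLinearMap f)
  map_add' f g := by simp
  map_smul' c f := by simp

theorem inner_sharp (f : Module.Dual ℝ V) (Z : V) : inner ℝ (sharp f) Z = f Z := by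
  simp [sharp]

/-- The endomorphism `A_𝔬` of a 2-form `A`: `g(A_𝔬 Y, Z) = 2 A(Y, Z)`, linearly in `A`. -/
def twoFormEnd : (V [⋀^Fin 2]→ₗ[ℝ] ℝ) →ₗ[ℝ] V →ₗ[ℝ] V :=
  LinearMap.mk₂ ℝ
    (fun A Y => sharp
      { toFun := fun Z => 2 * A ![Y, Z]
        map_add' := fun Z Z' => by
          have h : A ![Y, Z + Z'] = A ![Y, Z] + A ![Y, Z'] :=
            congrArg (fun f => f ![]) ((A.curryLeft Y).curryLeft.map_add Z Z')
          rw [h, mul_add]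
        map_smul' := fun c Z => by
          have h : A ![Y, c • Z] = c • A ![Y, Z] :=
            congrArg (fun f => f ![]) ((A.curryLeft Y).curryLeft.map_smul c Z)
          rw [h, mul_smul_comm, RingHom.id_apply] })
    (fun A A' Y => by
      rw [← map_add]; congr 1; ext Z; simp [mul_add])
    (fun c A Y => by
      rw [← map_smul]; congr 1; ext Z; simp; ring)
    (fun A Y Y' => by
      rw [← map_add]; congr 1; ext Z
      have h : A ![Y + Y', Z] = A ![Y, Z] + A ![Y', Z] :=
        congrArg (fun f => f ![Z]) (A.curryLeft.map_add Y Y')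
      simp [h, mul_add])
    (fun c A Y => by
      rw [← map_smul]; congr 1; ext Z
      have h : A ![c • Y, Z] = c • A ![Y, Z] :=
        congrArg (fun f => f ![Z]) (A.curryLeft.map_smul c Y)
      simp [h]; ring)

/-- The `𝔬(V)`-valued 1-form `A_𝔬` of a 3-form `A`: `g(A_𝔬(X) Y, Z) = 2 A(X, Y, Z)`,
see `inner_threeFormEnd`. -/
def threeFormEnd (A : V [⋀^Fin 3]→L[ℝ] ℝ) : V →ₗ[ℝ] V →ₗ[ℝ] V :=
  twoFormEnd ∘ₗ A.toAlternatingMap.curryLeft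

/-- The `𝔬(V)`-valued 2-form `A_𝔬` of a 4-form `A`: `g(A_𝔬(W, X) Y, Z) = 2 A(W, X, Y, Z)`,
see `inner_fourFormEnd`. -/
def fourFormEnd (A : V [⋀^Fin 4]→L[ℝ] ℝ) : V →ₗ[ℝ] V →ₗ[ℝ] V →ₗ[ℝ] V :=
  (AlternatingMap.curryLeftLinearMap ∘ₗ A.toAlternatingMap.curryLeft).compr₂ twoFormEnd

theorem inner_threeFormEnd (A : V [⋀^Fin 3]→L[ℝ] ℝ) (X Y Z : V) :
    inner ℝ (threeFormEnd A X Y) Z = 2 * A ![X, Y, Z] := by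
  simp [threeFormEnd, twoFormEnd, inner_sharp]

theorem inner_fourFormEnd (A : V [⋀^Fin 4]→L[ℝ] ℝ) (W X Y Z : V) :
    inner ℝ (fourFormEnd A W X Y) Z = 2 * A ![W, X, Y, Z] := by
  simp [fourFormEnd, twoFormEnd, inner_sharp]

/-- The transpose of an endomorphism-valued 2-form `A`:
`g(Aᵀ(X, Y) W, Z) = g(A(W, Z) X, Y)`, see `inner_transposeEnd`. -/
def transposeEnd (A : V →ₗ[ℝ] V →ₗ[ℝ] V →ₗ[ℝ] V) : V →ₗ[ℝ] V →ₗ[ℝ] V →ₗ[ℝ] V :=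
  LinearMap.mk₂ ℝ
    (fun X Y => sharp ∘ₗ LinearMap.mk₂ ℝ (fun W Z => inner ℝ (A W Z X) Y)
      (fun _ _ _ => by simp [inner_add_left]) (fun _ _ _ => by simp [inner_smul_left])
      (fun _ _ _ => by simp [inner_add_left]) (fun _ _ _ => by simp [inner_smul_left]))
    (fun X X' Y => by
      ext W; refine ext_inner_right ℝ fun Z => ?_
      simp [inner_sharp, inner_add_left])
    (fun c X Y => by
      ext W; refine ext_inner_right ℝ fun Z => ?_
      simp [inner_sharp, inner_smul_left])
    (fun X Y Y' => by
      ext W; refine ext_inner_right ℝ fun Z => ?_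
      simp [inner_sharp, inner_add_left, inner_add_right])
    (fun c X Y => by
      ext W; refine ext_inner_right ℝ fun Z => ?_
      simp [inner_sharp, inner_smul_left, inner_smul_right])

theorem inner_transposeEnd (A : V →ₗ[ℝ] V →ₗ[ℝ] V →ₗ[ℝ] V) (X Y W Z : V) :
    inner ℝ (transposeEnd A X Y W) Z = inner ℝ (A W Z X) Y := by
  simp [transposeEnd, inner_sharp]

end Pointwise

/- ### The form `det^{1/2}((Ω/2)/sinh(Ω/2))` -/

section Genus

variable (V : Type*) [NormedAddCommGroup V] [InnerProductSpace ℝ V]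

/-- The complex exterior algebra `⋀ V*_ℂ`, with `V*_ℂ` the real-linear maps `V → ℂ`. -/
abbrev ComplexForms : Type _ := ExteriorAlgebra ℂ (V →ₗ[ℝ] ℂ)
/-- The centre of `⋀ V*_ℂ`. It is a commutative algebra that contains the forms of even degree,
so determinants of matrices of even forms are computed in it. -/
abbrev CentralForms : Type _ := Subalgebra.center ℂ (ComplexForms V)


theorem ι_mul_ι_mem_center {M : Type*} [AddCommGroup M] [Module ℂ M] (a b : M) :
    ExteriorAlgebra.ι ℂ a * ExteriorAlgebra.ι ℂ b ∈
      Subalgebra.center ℂ (ExteriorAlgebra ℂ M) := by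
  have anti (u v : M) : ExteriorAlgebra.ι ℂ u * ExteriorAlgebra.ι ℂ v =
      -(ExteriorAlgebra.ι ℂ v * ExteriorAlgebra.ι ℂ u) :=
    eq_neg_of_add_eq_zero_left (ExteriorAlgebra.ι_add_mul_swap u v)
  rw [Subalgebra.mem_center_iff]
  intro y
  induction y using ExteriorAlgebra.induction with
  | algebraMap r => exact Algebra.commutes r _
  | ι c =>
    rw [mul_assoc, anti b c, mul_neg, ← mul_assoc, ← mul_assoc, anti c a, neg_mul]
  | mul x y hx hy => rw [mul_assoc, hy, ← mul_assoc, hx, mul_assoc]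
  | add x y hx hy => rw [add_mul, mul_add, hx, hy]

variable {V} {n : ℕ}

/-- The covector `g(e_i, ·)` as a complex covector. -/
def dualCovector (e : OrthonormalBasis (Fin n) ℝ V) (i : Fin n) : V →ₗ[ℝ] ℂ :=
  Complex.ofRealCLM.toLinearMap ∘ₗ e.toBasis.coord i

/-- The element `∑_{i<j} η(e_i, e_j) e^i ∧ e^j` of `⋀² V*_ℂ` given by a 2-form `η`. -/
def twoFormElement (e : OrthonormalBasis (Fin n) ℝ V) (η : V → V → ℝ) : CentralForms V :=
  ⟨∑ i, ∑ j ∈ Finset.Ioi i, (η (e i) (e j) : ℂ) •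
      (ExteriorAlgebra.ι ℂ (dualCovector e i) * ExteriorAlgebra.ι ℂ (dualCovector e j)),
    Subalgebra.sum_mem _ fun _ _ => Subalgebra.sum_mem _ fun _ _ =>
      Subalgebra.smul_mem _ (ι_mul_ι_mem_center _ _) _⟩

/-- The matrix `A_{ab} = g(A e_b, e_a)` of 2-forms of an endomorphism-valued 2-form `A`, in the
orthonormal basis `e`. -/
def formMatrix (e : OrthonormalBasis (Fin n) ℝ V) (A : V →ₗ[ℝ] V →ₗ[ℝ] V →ₗ[ℝ] V) :
    Matrix (Fin n) (Fin n) (CentralForms V) :=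
  fun a b => twoFormElement e fun X Y => inner ℝ (A X Y (e b)) (e a)

/-- The power series of `sinh(z/2) / (z/2)`. -/
def sinhcHalf : PowerSeries ℂ :=
  PowerSeries.mk fun k => if Even k then ((2 : ℂ) ^ k * (k + 1).factorial)⁻¹ else 0

/-- The power series of `(z/2) / sinh(z/2)`. -/
def ahatSeries : PowerSeries ℂ := sinhcHalf⁻¹

/-- The binomial series of `(1 + z)^{1/2}`. -/
def sqrtSeries : PowerSeries ℂ := PowerSeries.mk fun k => Ring.choose (1 / 2 : ℂ) k

/-- The value `f(z)` of a power series at an element `z` with `z ^ (n + 1) = 0`. It is used for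
matrices and elements of the exterior algebra of an `n`-dimensional space that have no component of
degree `0`; for these the sum is the complete series. -/
def evalNilpotent {R : Type*} [Ring R] [Algebra ℂ R] (n : ℕ) (f : PowerSeries ℂ) (z : R) : R :=
  ∑ k ∈ Finset.range (n + 1), PowerSeries.coeff k f • z ^ k

/-- `det^{1/2}((Ω/2) / sinh(Ω/2))` for a matrix `Ω` of 2-forms; the square root is the one with
component `1` in degree `0`, that is, the binomial series. -/
def ahatForm (Ω : Matrix (Fin n) (Fin n) (CentralForms V)) : ComplexForms V :=
  (evalNilpotent n sqrtSeries ((evalNilpotent n ahatSeries Ω).det - 1) : CentralForms V)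

/-- The constant term `det^{1/2}((tA/2) / sinh(tA/2))` in Mehler's formula, for the
endomorphism-valued 2-form `A`. -/
def mehlerForm (e : OrthonormalBasis (Fin n) ℝ V) (A : V →ₗ[ℝ] V →ₗ[ℝ] V →ₗ[ℝ] V) (t : ℂ) :
    ComplexForms V := ahatForm (t • formMatrix e A)

/-- The Chern-Weil `Â`-form `det^{1/2}((Ω/2) / sinh(Ω/2))`, `Ω = R / (2πi)`, of a connection on the
tangent bundle with curvature `R`. -/
def chernWeilAhat (e : OrthonormalBasis (Fin n) ℝ V) (A : V →ₗ[ℝ] V →ₗ[ℝ] V →ₗ[ℝ] V) :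
    ComplexForms V := ahatForm ((2 * Real.pi * Complex.I)⁻¹ • formMatrix e A)

/-- The component of degree `k` of a form. -/
def formDegree (k : ℕ) : ComplexForms V →+ ComplexForms V :=
  GradedRing.proj (fun i : ℕ => ⋀[ℂ]^i (V →ₗ[ℝ] ℂ)) k

end Genus

/- ### Forms, connections and curvature on a manifold -/

section Manifold

variable {E : Type*} [NormedAddCommGroup E] [NormedSpace ℝ E]
  {H : Type*} [TopologicalSpace H] (I : ModelWithCorners ℝ E H)
  {M : Type*} [TopologicalSpace M] [ChartedSpace H M]

/-- The expression of a differential form in the chart at `x₀`: the pull-back by the inverse of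
the chart. -/
def formInChart {k : ℕ} (η : Π x : M, TangentSpace I x [⋀^Fin k]→L[ℝ] ℝ) (x₀ : M) :
    E → E [⋀^Fin k]→L[ℝ] ℝ :=
  fun y => (η ((extChartAt I x₀).symm y)).compContinuousLinearMap
    (mfderivWithin 𝓘(ℝ, E) I (extChartAt I x₀).symm (Set.range I) y)

/-- A differential form is smooth if its expressions in the charts are. -/
def IsSmoothForm {k : ℕ} (η : Π x : M, TangentSpace I x [⋀^Fin k]→L[ℝ] ℝ) : Prop :=
  ∀ x₀ : M, ContDiffOn ℝ ∞ (formInChart I η x₀) (extChartAt I x₀).target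

/-- The exterior derivative of a differential form, computed in the chart at `x`. -/
def mextDeriv {k : ℕ} (η : Π x : M, TangentSpace I x [⋀^Fin k]→L[ℝ] ℝ) (x : M) :
    TangentSpace I x [⋀^Fin (k + 1)]→L[ℝ] ℝ :=
  (extDerivWithin (formInChart I η x) (Set.range I) (extChartAt I x x)).compContinuousLinearMap
    (mfderiv I 𝓘(ℝ, E) (extChartAt I x) x)

variable [IsManifold I ∞ M]

/-- `R(X, Y) Z = ∇_X ∇_Y Z - ∇_Y ∇_X Z - ∇_{[X, Y]} Z` for vector fields. (In Mathlib
`cov Z x (X x)` is `∇_X Z` at `x`.) -/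
def curvatureField (cov : CovariantDerivative I E (TangentSpace I : M → Type _))
    (X Y Z : Π x : M, TangentSpace I x) (x : M) : TangentSpace I x :=
  cov (fun y => cov Z y (Y y)) x (X x) - cov (fun y => cov Z y (X y)) x (Y x)
    - cov Z x (VectorField.mlieBracket I X Y x)

variable [FiniteDimensional ℝ E]

instance instFiniteDimensionalTangentSpace (x : M) : FiniteDimensional ℝ (TangentSpace I x) :=
  inferInstanceAs (FiniteDimensional ℝ E)

/-- The curvature tensor `R(u, v) w` at `x`, as a trilinear map. It is given by its values on the
members of a basis of `T_x M`, extended to vector fields that are constant in the chart at `x`, that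
is, `R = ∑ u^i v^j w^k R(∂_i, ∂_j) ∂_k`. -/
def curvature (cov : CovariantDerivative I E (TangentSpace I : M → Type _)) (x : M) :
    TangentSpace I x →ₗ[ℝ] TangentSpace I x →ₗ[ℝ] TangentSpace I x →ₗ[ℝ] TangentSpace I x :=
  let b := Module.finBasis ℝ (TangentSpace I x)
  b.constr ℝ fun i => b.constr ℝ fun j => b.constr ℝ fun k =>
    curvatureField I cov (extend E (b i)) (extend E (b j)) (extend E (b k)) x

variable [RiemannianBundle (fun x : M => TangentSpace I x)]
  [IsContMDiffRiemannianBundle I ∞ E (fun x : M => TangentSpace I x)]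

/-- The Koszul expression for `g(∇_X Y, Z)` of the Levi-Civita connection. -/
def koszul (Y X Z : Π x : M, TangentSpace I x) (x : M) : ℝ :=
  1 / 2 * (d% (fun y => inner ℝ (Y y) (Z y)) x (X x) + d% (fun y => inner ℝ (X y) (Z y)) x (Y x)
    - d% (fun y => inner ℝ (X y) (Y y)) x (Z x)
    + inner ℝ (VectorField.mlieBracket I X Y x) (Z x)
    - inner ℝ (VectorField.mlieBracket I X Z x) (Y x)
    - inner ℝ (VectorField.mlieBracket I Y Z x) (X x))

variable [CompleteSpace E]

theorem mdifferentiableAt_inner {X Y : Π x : M, TangentSpace I x} {x : M}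
    (hX : MDiffAt (T% X) x) (hY : MDiffAt (T% Y) x) :
    MDiffAt (fun y => (inner ℝ (X y) (Y y) : ℝ)) x :=
  MDifferentiableAt.inner_bundle (F := E) (E := fun x : M => TangentSpace I x) hX hY

theorem tensorialAt_koszul_left {Y Z : Π x : M, TangentSpace I x} {x : M}
    (hY : MDiffAt (T% Y) x) (hZ : MDiffAt (T% Z) x) :
    TensorialAt I E (fun X => koszul I Y X Z x) x where
  smul {f X} hf hX := by
    have h1 := mvfderiv_fun_mul hf (mdifferentiableAt_inner I hX hZ)
    have h2 := mvfderiv_fun_mul hf (mdifferentiableAt_inner I hX hY)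
    simp [koszul, inner_smul_left, inner_smul_right, VectorField.mlieBracket_smul_left hf hX,
      inner_add_left, h1, h2]
    ring
  add {X X'} hX hX' := by
    have h1 := mvfderiv_fun_add (mdifferentiableAt_inner I hX hZ) (mdifferentiableAt_inner I hX' hZ)
    have h2 := mvfderiv_fun_add (mdifferentiableAt_inner I hX hY) (mdifferentiableAt_inner I hX' hY)
    simp [koszul, inner_add_left, inner_add_right, VectorField.mlieBracket_add_left hX hX', h1, h2]
    ring

theorem tensorialAt_koszul_right {Y X : Π x : M, TangentSpace I x} {x : M}
    (hY : MDiffAt (T% Y) x) (hX : MDiffAt (T% X) x) :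
    TensorialAt I E (fun Z => koszul I Y X Z x) x where
  smul {f Z} hf hZ := by
    have h1 := mvfderiv_fun_mul hf (mdifferentiableAt_inner I hX hZ)
    have h2 := mvfderiv_fun_mul hf (mdifferentiableAt_inner I hY hZ)
    simp [koszul, inner_smul_left, inner_smul_right, VectorField.mlieBracket_smul_right hf hZ,
      inner_add_left, h1, h2]
    rw [real_inner_comm (Z x) (Y x), real_inner_comm (Z x) (X x)]
    ring
  add {Z Z'} hZ hZ' := by
    have h1 := mvfderiv_fun_add (mdifferentiableAt_inner I hX hZ) (mdifferentiableAt_inner I hX hZ')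
    have h2 := mvfderiv_fun_add (mdifferentiableAt_inner I hY hZ) (mdifferentiableAt_inner I hY hZ')
    simp [koszul, inner_add_left, inner_add_right, VectorField.mlieBracket_add_right hZ hZ', h1, h2]
    ring

open Classical in
/-- `∇_v Y` at `x`, given by `g(∇_v Y, w) = koszul Y v w`; by convention it is `0` where `Y` is not
differentiable. -/
def leviCivitaFun (Y : Π x : M, TangentSpace I x) (x : M) :
    TangentSpace I x →L[ℝ] TangentSpace I x :=
  if hY : MDiffAt (T% Y) x then
    LinearMap.toContinuousLinearMap
      (sharp ∘ₗ ContinuousLinearMap.coeLM ℝ ∘ₗ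
        (TensorialAt.mkHom₂ (fun X Z => koszul I Y X Z x) x
          (fun _ hZ => tensorialAt_koszul_left I hY hZ)
          (fun _ hX => tensorialAt_koszul_right I hY hX)).toLinearMap)
  else 0

theorem inner_leviCivitaFun {X Y Z : Π x : M, TangentSpace I x} {x : M}
    (hX : MDiffAt (T% X) x) (hY : MDiffAt (T% Y) x) (hZ : MDiffAt (T% Z) x) :
    inner ℝ (leviCivitaFun I Y x (X x)) (Z x) = koszul I Y X Z x := by
  simp only [leviCivitaFun, hY, dif_pos]
  refine (inner_sharp _ _).trans ?_
  exact TensorialAt.mkHom₂_apply (fun _ hZ => tensorialAt_koszul_left I hY hZ)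
          (fun _ hX => tensorialAt_koszul_right I hY hX) hX hZ

/-- The Levi-Civita connection, by the Koszul formula. -/
def leviCivita : CovariantDerivative I E (TangentSpace I : M → Type _) where
  toFun := leviCivitaFun I
  isCovariantDerivativeOnUniv :=
    { add := by
        intro Y Y' x hY hY' _
        ext v
        refine ext_inner_right ℝ fun w => ?_
        have hv := mdifferentiableAt_extend I E v
        have hw := mdifferentiableAt_extend I E w
        have key := inner_leviCivitaFun I hv (mdifferentiableAt_add_section hY hY') hw
        have k1 := inner_leviCivitaFun I hv hY hw
        have k2 := inner_leviCivitaFun I hv hY' hw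
        have h1 := mvfderiv_fun_add (mdifferentiableAt_inner I hY hw)
          (mdifferentiableAt_inner I hY' hw)
        have h2 := mvfderiv_fun_add (mdifferentiableAt_inner I hv hY)
          (mdifferentiableAt_inner I hv hY')
        simp only [extend_apply_self] at key k1 k2
        rw [key, add_apply, inner_add_left, k1, k2]
        simp [koszul, inner_add_left, inner_add_right, VectorField.mlieBracket_add_right hY hY',
          VectorField.mlieBracket_add_left hY hY', h1, h2]
        ring
      leibniz := by
        intro Y f x hY hf _
        ext v
        refine ext_inner_right ℝ fun w => ?_
        have hv := mdifferentiableAt_extend I E v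
        have hw := mdifferentiableAt_extend I E w
        have key := inner_leviCivitaFun I hv (hf.smul_section hY) hw
        have k1 := inner_leviCivitaFun I hv hY hw
        have h1 := mvfderiv_fun_mul hf (mdifferentiableAt_inner I hY hw)
        have h2 := mvfderiv_fun_mul hf (mdifferentiableAt_inner I hv hY)
        simp only [extend_apply_self] at key k1
        rw [key]
        simp [koszul, inner_add_left, inner_smul_left, inner_smul_right,
          VectorField.mlieBracket_smul_right hf hY,
          VectorField.mlieBracket_smul_left hf hY, h1, h2, k1]
        rw [real_inner_comm v (Y x)]
        ring }

/-- The Levi-Civita connection is torsion-free. -/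
theorem torsion_leviCivita : (leviCivita I (M := M)).torsion = 0 := by
  rw [CovariantDerivative.torsion_eq_zero_iff]
  intro X Y x hX hY
  refine ext_inner_right ℝ fun w => ?_
  have hw := mdifferentiableAt_extend I E w
  have k1 := inner_leviCivitaFun I hX hY hw
  have k2 := inner_leviCivitaFun I hY hX hw
  simp only [extend_apply_self] at k1 k2
  rw [inner_sub_left]
  refine (congrArg₂ (· - ·) k1 k2).trans ?_
  have hc : (fun y => (inner ℝ (X y) (Y y) : ℝ)) = fun y => inner ℝ (Y y) (X y) :=
    funext fun y => real_inner_comm _ _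
  simp [koszul, hc]
  rw [VectorField.mlieBracket_swap_apply (V := Y) (W := X), inner_neg_left]
  ring

/-- The Levi-Civita connection is metric. -/
theorem leviCivita_metric {X Y Z : Π x : M, TangentSpace I x} {x : M}
    (hX : MDiffAt (T% X) x) (hY : MDiffAt (T% Y) x) (hZ : MDiffAt (T% Z) x) :
    d% (fun y => (inner ℝ (Y y) (Z y) : ℝ)) x (X x) =
      inner ℝ (leviCivita I Y x (X x)) (Z x) + inner ℝ (Y x) (leviCivita I Z x (X x)) := by
  have k1 := inner_leviCivitaFun I hX hY hZ
  have k2 := inner_leviCivitaFun I hX hZ hY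
  refine Eq.symm ((congrArg₂ (· + ·) k1 ((real_inner_comm _ _).trans k2)).trans ?_)
  have hc (X Y : Π x : M, TangentSpace I x) :
      (fun y => (inner ℝ (X y) (Y y) : ℝ)) = fun y => inner ℝ (Y y) (X y) :=
    funext fun y => real_inner_comm _ _
  simp [koszul]
  rw [VectorField.mlieBracket_swap_apply (V := Z) (W := Y), inner_neg_left, hc Z Y]
  ring

/-- `B_𝔬` as a 1-form with values in the endomorphisms of `TM`, with the argument order of
`CovariantDerivative.addOneForm`. -/
def endOneForm (B : Π x : M, TangentSpace I x [⋀^Fin 3]→L[ℝ] ℝ) (x : M) :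
    TangentSpace I x →L[ℝ] TangentSpace I x →L[ℝ] TangentSpace I x :=
  (threeFormEnd (B x)).flip.toContinuousBilinearMap

theorem endOneForm_apply (B : Π x : M, TangentSpace I x [⋀^Fin 3]→L[ℝ] ℝ) (x : M)
    (X Y : TangentSpace I x) : endOneForm I B x Y X = threeFormEnd (B x) X Y := rfl

/-- The connection `∇ = ∇^{LC} + B_𝔬`. -/
def connectionPlus (B : Π x : M, TangentSpace I x [⋀^Fin 3]→L[ℝ] ℝ) :
    CovariantDerivative I E (TangentSpace I : M → Type _) :=
  (leviCivita I).addOneForm (endOneForm I B)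

/-- The connection `∇₋ = ∇^{LC} - B_𝔬`. -/
def connectionMinus (B : Π x : M, TangentSpace I x [⋀^Fin 3]→L[ℝ] ℝ) :
    CovariantDerivative I E (TangentSpace I : M → Type _) :=
  (leviCivita I).addOneForm fun x => -endOneForm I B x

end Manifold

end SkewTorsion

end

open SkewTorsion

/-! Work with the fields that are constant in the chart at `x`. Their brackets vanish, so
`g(R(u,v)w, z)` is a difference of first derivatives of Christoffel symbols plus terms quadratic in
the connection. As `B_𝔬` is skew, `∇` is metric, and the quadratic terms are `-g(∇_v w, ∇_u z) +
g(∇_u w, ∇_v z)` (`inner_curvatureField_chartField`). The Levi-Civita connection is torsion-free and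
`B_𝔬(v)w` is antisymmetric in `v`, `w`, so `∇_v w = ∇₋_w v` (`connectionPlus_chartField_swap`). This
turns the quadratic terms of `g(R(w,z)u, v)` into those of `g(R₋(u,v)w, z)`. The second derivatives
of the metric agree by the symmetry of mixed partials, and the four remaining derivatives of
components of `B` add up to `2 dB(u,v,w,z)` (`transpose_curvatureField_chartField`).

The statement on the genus is a matter of grading. For a matrix `Ω` of 2-forms, `det^{1/2}` of `X •
Ω`, with a formal variable `X`, is a polynomial whose coefficient at `X^j` has degree `2j`
(`ahatElement_formalMultiple_mem`). Mehler's term is its value at `X = t` and the Chern-Weil form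
its value at `X = 1/(2πi)`. -/

noncomputable section
namespace SkewTorsion

open scoped Topology Matrix

/-! ### Vector fields that are constant in a chart, and derivatives along them. -/

section ChartFields

variable {E : Type*} [NormedAddCommGroup E] [NormedSpace ℝ E]
  {H : Type*} [TopologicalSpace H] (I : ModelWithCorners ℝ E H)
  {M : Type*} [TopologicalSpace M] [ChartedSpace H M] [IsManifold I ∞ M]

/-- The vector field that is constantly `v` in the chart at `x`. -/
def chartField (x : M) (v : E) : Π y : M, TangentSpace I y := extend E (x := x) v

theorem chartField_self (x : M) (v : E) : chartField I x v x = v :=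
  extend_apply_self (E := TangentSpace I) E (x := x) v

theorem chartField_eq_symmL {x y : M} (v : E) (hy : y ∈ (chartAt H x).source) :
    chartField I x v y = (trivializationAt E (TangentSpace I) x).symmL ℝ y v := by
  -- Over its base point the trivialization of the tangent bundle is the identity.
  have hx : (trivializationAt E (TangentSpace I) x ⟨x, (v : TangentSpace I x)⟩).2 = v :=
    (tangentBundleCore I M).coordChange_self (achart H x) x (mem_chart_source H x) v
  refine Eq.trans ?_ (Trivialization.symmL_apply (R := ℝ) _ (by simpa using hy) v).symm
  exact congrArg (fun w => (trivializationAt E (TangentSpace I) x).symm y w) hx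

theorem chartField_eq_mfderivWithin_symm {x y : M} (v : E) (hy : y ∈ (chartAt H x).source) :
    chartField I x v y = mfderivWithin 𝓘(ℝ, E) I (extChartAt I x).symm (Set.range I)
      (extChartAt I x y) v :=
  (chartField_eq_symmL I v hy).trans
    (congrArg (fun f : E →L[ℝ] E => f v) (TangentBundle.symmL_trivializationAt hy))

theorem mfderiv_extChartAt_chartField {x y : M} (v : E) (hy : y ∈ (chartAt H x).source) :
    mfderiv I 𝓘(ℝ, E) (extChartAt I x) y (chartField I x v y) = v :=
  (congrArg _ (chartField_eq_mfderivWithin_symm I v hy)).trans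
    (congrArg (fun f : E →L[ℝ] E => f v)
      (mfderiv_extChartAt_comp_mfderivWithin_extChartAt_symm' (I := I)
        (x := x) (y := y) (by simpa using hy)))

/-- The constant vector field on the model space. -/
def constField (v : E) : Π z : E, TangentSpace 𝓘(ℝ, E) z := fun _ => v

theorem mlieBracket_constField (v w : E) :
    VectorField.mlieBracket 𝓘(ℝ, E) (constField v) (constField w) = 0 := by
  rw [← VectorField.mlieBracketWithin_univ, VectorField.mlieBracketWithin_eq_lieBracketWithin]
  ext z
  have h (u : E) : fderivWithin ℝ (constField u) Set.univ z = 0 := fderivWithin_const_apply _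
  simp only [VectorField.lieBracketWithin, h]
  exact sub_self (0 : E)

theorem chartField_eq_mpullback {x y : M} (v : E) (hy : y ∈ (chartAt H x).source) :
    chartField I x v y = VectorField.mpullback I 𝓘(ℝ, E) (extChartAt I x) (constField v) y := by
  have h := isInvertible_mfderiv_extChartAt (I := I) (x := x) (y := y) (by simpa using hy)
  rw [VectorField.mpullback_apply]
  refine Eq.trans ?_ (congrArg _ (mfderiv_extChartAt_chartField I v hy))
  exact (congrArg (fun f => f (chartField I x v y)) h.inverse_comp_self).symm

/-- Brackets are natural under pull-back by the chart, and constant fields on the model space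
commute. -/
theorem mlieBracket_chartField [CompleteSpace E] {x y : M} (v w : E)
    (hy : y ∈ (chartAt H x).source) :
    VectorField.mlieBracket I (chartField I x v) (chartField I x w) y = 0 := by
  have hev (u : E) : chartField I x u =ᶠ[𝓝 y]
      VectorField.mpullback I 𝓘(ℝ, E) (extChartAt I x) (constField u) := by
    filter_upwards [(chartAt H x).open_source.mem_nhds hy] with z hz
    exact chartField_eq_mpullback I u hz
  have hc (u : E) : MDiffAt (T% (constField u)) (extChartAt I x y) :=
    ((contMDiffAt_vectorSpace_iff_contDiffAt (n := 1)).2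
      contDiffAt_const).mdifferentiableAt one_ne_zero
  have : IsManifold I (minSmoothness ℝ 2) M := by
    rw [minSmoothness_of_isRCLikeNormedField]; infer_instance
  rw [(hev v).mlieBracket_vectorField_eq (hev w),
    ← VectorField.mpullback_mlieBracket (n := 2) (hc v) (hc w)
    ((contMDiffAt_extChartAt' hy).of_le (WithTop.coe_le_coe.2 le_top)) (by simp), VectorField.mpullback_apply,
    mlieBracket_constField]
  exact map_zero _

theorem contMDiffOn_chartField (x : M) (v : E) :
    CMDiff[(chartAt H x).source] ∞ (T% (chartField I x v)) := by
  -- One derivative is lost in passing to the tangent bundle, and `∞ + 1` reduces to `∞`.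
  have : IsManifold I (∞ + 1) M := ‹IsManifold I ∞ M›
  have := TangentBundle.contMDiffVectorBundle (n := ∞) (I := I) (M := M)
  refine (Trivialization.contMDiffOn_section_baseSet_iff (IB := I) (n := ∞)
    (trivializationAt E (TangentSpace I) x) (s := chartField I x v)).2 ?_
  refine (contMDiffOn_const (c := v)).congr fun y hy => ?_
  have h := (chartField_eq_symmL I v hy).trans (Trivialization.symmL_apply (R := ℝ) _ hy v)
  rw [h, Trivialization.apply_mk_symm _ hy]

variable {I}

theorem mvfderiv_chartField [I.Boundaryless] {x y : M} {f : M → ℝ} (v : E)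
    (hy : y ∈ (chartAt H x).source) (hf : MDiffAt f y) :
    d% f y (chartField I x v y) =
      fderiv ℝ (f ∘ (extChartAt I x).symm) (extChartAt I x y) v := by
  have hy' : y ∈ (extChartAt I x).source := by simpa using hy
  have h1 : MDifferentiableAt 𝓘(ℝ, E) I (extChartAt I x).symm (extChartAt I x y) := by
    have := mdifferentiableWithinAt_extChartAt_symm (I := I) ((extChartAt I x).map_source hy')
    rwa [I.range_eq_univ, mdifferentiableWithinAt_univ] at this
  have h2 := mvfderiv_comp_apply_of_eq (g := f) (f := (extChartAt I x).symm) (extChartAt I x y) hf h1 ((extChartAt I x).left_inv hy') v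
  have h3 := chartField_eq_mfderivWithin_symm I v hy
  rw [I.range_eq_univ, mfderivWithin_univ] at h3
  refine (congrArg _ h3).trans ?_
  refine h2.symm.trans ?_
  exact congrArg (fun L : E →L[ℝ] ℝ => L v) mfderiv_eq_fderiv

theorem contDiffOn_comp_extChartAt_symm [I.Boundaryless] {x : M} {f : M → ℝ}
    (hf : CMDiff[(chartAt H x).source] ∞ f) :
    ContDiffOn ℝ ∞ (f ∘ (extChartAt I x).symm) (extChartAt I x).target := by
  rw [← contMDiffOn_iff_contDiffOn]
  refine hf.comp (contMDiffOn_extChartAt_symm x) fun z hz => ?_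
  simpa using (extChartAt I x).map_target hz

theorem contMDiffOn_comp_extChartAt {x : M} {F : E → ℝ}
    (hF : ContDiffOn ℝ ∞ F (extChartAt I x).target) :
    CMDiff[(chartAt H x).source] ∞ (F ∘ extChartAt I x) :=
  (contMDiffOn_iff_contDiffOn.2 hF).comp (contMDiffOn_extChartAt (x := x)) fun z hz =>
    (extChartAt I x).map_source (by simpa using hz)

theorem mdifferentiableAt_of_contMDiffOn {x y : M} {f : M → ℝ}
    (hf : CMDiff[(chartAt H x).source] ∞ f) (hy : y ∈ (chartAt H x).source) : MDiffAt f y :=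
  (hf.contMDiffAt ((chartAt H x).open_source.mem_nhds hy)).mdifferentiableAt (by simp)

theorem contMDiffOn_mvfderiv_chartField [I.Boundaryless] {x : M} {f : M → ℝ} (v : E)
    (hf : CMDiff[(chartAt H x).source] ∞ f) :
    CMDiff[(chartAt H x).source] ∞ (fun y => d% f y (chartField I x v y)) := by
  have h1 := (contDiffOn_comp_extChartAt_symm hf).fderiv_of_isOpen (m := ∞)
    (isOpen_extChartAt_target x) le_rfl
  have h2 := contMDiffOn_comp_extChartAt (I := I) (x := x) (h1.clm_apply (contDiffOn_const (c := v)))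
  exact h2.congr fun y hy => mvfderiv_chartField v hy (mdifferentiableAt_of_contMDiffOn hf hy)

theorem mvfderiv_comp_extChartAt_chartField {x : M} {F : E → ℝ} (v : E)
    (hF : DifferentiableAt ℝ F (extChartAt I x x)) :
    d% (F ∘ extChartAt I x) x (chartField I x v x) = fderiv ℝ F (extChartAt I x x) v := by
  have h1 : MDifferentiableAt I 𝓘(ℝ, E) (extChartAt I x) x :=
    mdifferentiableAt_extChartAt (mem_chart_source H x)
  refine (mvfderiv_comp_apply_of_eq (g := F) (f := extChartAt I x) x
    hF.mdifferentiableAt h1 rfl _).trans ?_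
  refine (congrArg _ (mfderiv_extChartAt_chartField I v (mem_chart_source H x))).trans ?_
  exact congrArg (fun L : E →L[ℝ] ℝ => L v) mfderiv_eq_fderiv

theorem mvfderiv_congr_of_eventuallyEq {x : M} {f g : M → ℝ} (h : f =ᶠ[𝓝 x] g) :
    d% f x = d% g x := by
  ext v
  exact congrArg (fun L : E →L[ℝ] ℝ => L v) h.mfderiv_eq

/-- In the chart this is the symmetry of the second derivative. It is applied to the components of
the metric. -/
theorem mvfderiv_chartField_comm [I.Boundaryless] {x : M} {f : M → ℝ} (v w : E)
    (hf : CMDiff[(chartAt H x).source] ∞ f) :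
    d% (fun y => d% f y (chartField I x v y)) x (chartField I x w x) =
      d% (fun y => d% f y (chartField I x w y)) x (chartField I x v x) := by
  have hF := contDiffOn_comp_extChartAt_symm hf
  have hx : (extChartAt I x).target ∈ 𝓝 (extChartAt I x x) := extChartAt_target_mem_nhds x
  have hd : DifferentiableAt ℝ (fderiv ℝ (f ∘ (extChartAt I x).symm)) (extChartAt I x x) :=
    ((hF.fderiv_of_isOpen (m := ∞) (isOpen_extChartAt_target x) le_rfl).contDiffAt
      hx).differentiableAt (by simp)
  have key (u u' : E) : d% (fun y => d% f y (chartField I x u y)) x (chartField I x u' x) =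
      fderiv ℝ (fderiv ℝ (f ∘ (extChartAt I x).symm)) (extChartAt I x x) u' u := by
    have h1 : (fun y => d% f y (chartField I x u y)) =ᶠ[𝓝 x]
        (fun z => fderiv ℝ (f ∘ (extChartAt I x).symm) z u) ∘ extChartAt I x := by
      filter_upwards [chart_source_mem_nhds H x] with y hy
      exact mvfderiv_chartField u hy (mdifferentiableAt_of_contMDiffOn hf hy)
    rw [mvfderiv_congr_of_eventuallyEq h1,
      mvfderiv_comp_extChartAt_chartField u' (hd.clm_apply (differentiableAt_const u)),
      fderiv_clm_apply hd (differentiableAt_const u)]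
    simp
  rw [key, key]
  exact ((hF.contDiffAt hx).isSymmSndFDerivAt (by
    rw [minSmoothness_of_isRCLikeNormedField]; exact WithTop.coe_le_coe.2 le_top)).eq _ _

end ChartFields

/-! ### Symmetries of alternating 3-forms. -/

section ThreeForm

variable {V : Type*} [AddCommGroup V] [Module ℝ V] [TopologicalSpace V]

theorem threeForm_swap (A : V [⋀^Fin 3]→L[ℝ] ℝ) (X Y Z : V) : A ![X, Y, Z] = -A ![Y, X, Z] := by
  refine Eq.trans ?_ (A.map_swap ![Y, X, Z] (show (0 : Fin 3) ≠ 1 by decide))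
  refine congrArg A ?_
  funext i
  fin_cases i <;> rfl

theorem threeForm_rotate (A : V [⋀^Fin 3]→L[ℝ] ℝ) (X Y Z : V) : A ![X, Y, Z] = A ![Y, Z, X] := by
  have h : A ![Y, X, Z] = -A ![Y, Z, X] := by
    refine Eq.trans ?_ (A.map_swap ![Y, Z, X] (show (1 : Fin 3) ≠ 2 by decide))
    refine congrArg A ?_
    funext i
    fin_cases i <;> rfl
  rw [threeForm_swap, h, neg_neg]

end ThreeForm

/-! ### Components of forms and of the exterior derivative in a chart. -/

section FormComponents

variable {E : Type*} [NormedAddCommGroup E] [NormedSpace ℝ E]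
  {H : Type*} [TopologicalSpace H] {I : ModelWithCorners ℝ E H}
  {M : Type*} [TopologicalSpace M] [ChartedSpace H M] [IsManifold I ∞ M] {k : ℕ}

theorem apply_chartField_eq_formInChart (η : Π x : M, TangentSpace I x [⋀^Fin k]→L[ℝ] ℝ)
    {x y : M} (v : Fin k → E) (hy : y ∈ (chartAt H x).source) :
    η y (fun i => chartField I x (v i) y) = formInChart I η x (extChartAt I x y) v := by
  have hy' : y ∈ (extChartAt I x).source := by simpa using hy
  -- The type of `η y` depends on `y`, so the point is replaced by the image of a chart point `z`
  -- instead of being rewritten.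
  obtain ⟨z, hz, rfl⟩ : ∃ z ∈ (extChartAt I x).target, (extChartAt I x).symm z = y :=
    ⟨_, (extChartAt I x).map_source hy', (extChartAt I x).left_inv hy'⟩
  have hr := (extChartAt I x).right_inv hz
  have h : (fun i => chartField I x (v i) ((extChartAt I x).symm z)) = fun i =>
      mfderivWithin 𝓘(ℝ, E) I (extChartAt I x).symm (Set.range I) z (v i) := by
    funext i
    refine (chartField_eq_mfderivWithin_symm I (v i) hy).trans ?_
    exact congrArg (fun w : E => (mfderivWithin 𝓘(ℝ, E) I (extChartAt I x).symm (Set.range I) w :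
      E →L[ℝ] E) (v i)) hr
  refine (congrArg _ h).trans ?_
  exact congrArg (fun w : E => formInChart I η x w v) hr.symm

theorem contDiffOn_formInChart_apply {η : Π x : M, TangentSpace I x [⋀^Fin k]→L[ℝ] ℝ}
    (hη : IsSmoothForm I η) (x : M) (v : Fin k → E) :
    ContDiffOn ℝ ∞ (fun z => formInChart I η x z v) (extChartAt I x).target :=
  (ContinuousAlternatingMap.apply ℝ E ℝ v).contDiff.comp_contDiffOn (hη x)

theorem contMDiffOn_form_apply_chartField {η : Π x : M, TangentSpace I x [⋀^Fin k]→L[ℝ] ℝ}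
    (hη : IsSmoothForm I η) (x : M) (v : Fin k → E) :
    CMDiff[(chartAt H x).source] ∞ (fun y => η y (fun i => chartField I x (v i) y)) :=
  (contMDiffOn_comp_extChartAt (contDiffOn_formInChart_apply hη x v)).congr
    fun _ hy => apply_chartField_eq_formInChart η v hy

/-- The differential of the chart makes the fields constant, so only the alternating sum of partial
derivatives of the components is left, without bracket terms. -/
theorem mextDeriv_apply_chartField [I.Boundaryless]
    {η : Π x : M, TangentSpace I x [⋀^Fin k]→L[ℝ] ℝ} (hη : IsSmoothForm I η) (x : M)
    (v : Fin (k + 1) → E) :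
    mextDeriv I η x (fun i => chartField I x (v i) x) =
      ∑ i, (-1) ^ i.val * d% (fun y => η y (fun j => chartField I x (i.removeNth v j) y)) x
        (chartField I x (v i) x) := by
  have hx : (extChartAt I x).target ∈ 𝓝 (extChartAt I x x) := extChartAt_target_mem_nhds x
  have hd : DifferentiableAt ℝ (formInChart I η x) (extChartAt I x x) :=
    ((hη x).contDiffAt hx).differentiableAt (by simp)
  have h1 : mextDeriv I η x (fun i => chartField I x (v i) x) =
      extDeriv (formInChart I η x) (extChartAt I x x) v := by
    rw [← extDerivWithin_univ, ← I.range_eq_univ]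
    refine congrArg (extDerivWithin (formInChart I η x) (Set.range I) (extChartAt I x x)) ?_
    funext i
    exact mfderiv_extChartAt_chartField I (v i) (mem_chart_source H x)
  rw [h1, extDeriv_apply hd]
  refine Finset.sum_congr rfl fun i _ => ?_
  have h2 : (fun y => η y (fun j => chartField I x (i.removeNth v j) y)) =ᶠ[𝓝 x]
      (fun z => formInChart I η x z (i.removeNth v)) ∘ extChartAt I x := by
    filter_upwards [chart_source_mem_nhds H x] with y hy
    exact apply_chartField_eq_formInChart η _ hy
  rw [mvfderiv_congr_of_eventuallyEq h2, mvfderiv_comp_extChartAt_chartField (v i)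
    (((contDiffOn_formInChart_apply hη x _).contDiffAt hx).differentiableAt (by simp))]
  simp

theorem isSmoothForm_neg {η : Π x : M, TangentSpace I x [⋀^Fin k]→L[ℝ] ℝ}
    (hη : IsSmoothForm I η) : IsSmoothForm I fun x => -η x :=
  fun x₀ => (hη x₀).neg

/-- The component `B(u, v, w)` of a 3-form with respect to vectors that are constant in the chart
at `x`. -/
def chartComponent (B : Π x : M, TangentSpace I x [⋀^Fin 3]→L[ℝ] ℝ) (x : M) (u v w : E) (y : M) :
    ℝ :=
  B y ![chartField I x u y, chartField I x v y, chartField I x w y]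

theorem chartComponent_eq (B : Π x : M, TangentSpace I x [⋀^Fin 3]→L[ℝ] ℝ) (x : M) (u v w : E) :
    chartComponent B x u v w = fun y => B y fun i => chartField I x (![u, v, w] i) y := by
  funext y
  refine congrArg (fun f => B y f) ?_
  funext i
  fin_cases i <;> rfl

theorem contMDiffOn_chartComponent {B : Π x : M, TangentSpace I x [⋀^Fin 3]→L[ℝ] ℝ}
    (hB : IsSmoothForm I B) (x : M) (u v w : E) :
    CMDiff[(chartAt H x).source] ∞ (chartComponent B x u v w) := by
  rw [chartComponent_eq]
  exact contMDiffOn_form_apply_chartField hB x _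

theorem chartComponent_neg (B : Π x : M, TangentSpace I x [⋀^Fin 3]→L[ℝ] ℝ) (x : M) (u v w : E) :
    chartComponent (fun x => -B x) x u v w = -chartComponent B x u v w := rfl

theorem chartComponent_rotate (B : Π x : M, TangentSpace I x [⋀^Fin 3]→L[ℝ] ℝ) (x : M)
    (u v w : E) : chartComponent B x u v w = chartComponent B x v w u :=
  funext fun _ => threeForm_rotate _ _ _ _

theorem mextDeriv_chartField [I.Boundaryless] {B : Π x : M, TangentSpace I x [⋀^Fin 3]→L[ℝ] ℝ}
    (hB : IsSmoothForm I B) (x : M) (t u v w : E) :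
    mextDeriv I B x ![chartField I x t x, chartField I x u x, chartField I x v x,
        chartField I x w x] =
      d% (chartComponent B x u v w) x (chartField I x t x)
      - d% (chartComponent B x t v w) x (chartField I x u x)
      + d% (chartComponent B x t u w) x (chartField I x v x)
      - d% (chartComponent B x t u v) x (chartField I x w x) := by
  have h := mextDeriv_apply_chartField hB x ![t, u, v, w]
  have h1 : (fun i => chartField I x (![t, u, v, w] i) x) =
      ![chartField I x t x, chartField I x u x, chartField I x v x, chartField I x w x] := by
    funext i
    fin_cases i <;> rfl
  have h2 (i : Fin 4) : (fun y => B y fun j => chartField I x (i.removeNth ![t, u, v, w] j) y) =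
      ![chartComponent B x u v w, chartComponent B x t v w, chartComponent B x t u w,
        chartComponent B x t u v] i := by
    fin_cases i <;>
    · refine Eq.trans ?_ (chartComponent_eq B x _ _ _).symm
      funext y
      refine congrArg (fun f => B y f) ?_
      funext j
      fin_cases j <;> rfl
  rw [← h1]
  refine h.trans ((Fin.sum_univ_four _).trans ?_)
  simp only [h2]
  simp
  ring

end FormComponents

/-! ### Smoothness of matrix inversion. -/

section MatrixInverse

variable {ι : Type*} [Fintype ι] [DecidableEq ι]

theorem contDiffAt_det {F : Type*} [NormedAddCommGroup F] [NormedSpace ℝ F]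
    {f : F → Matrix ι ι ℝ} {a : F} (hf : ∀ i j, ContDiffAt ℝ ∞ (fun z => f z i j) a) :
    ContDiffAt ℝ ∞ (fun z => (f z).det) a := by
  simp only [Matrix.det_apply]
  exact ContDiffAt.sum fun σ _ => (contDiffAt_prod fun i _ => hf _ _).const_smul _

/-- Cramer's rule: an entry of the inverse is a cofactor divided by the determinant, and both are
polynomials in the entries. The inverse of the Gram matrix of the metric is the case needed. -/
theorem contDiffAt_inv_apply {A : ι → ι → ℝ} (hA : (Matrix.of A).det ≠ 0) (i j : ι) :
    ContDiffAt ℝ ∞ (fun A : ι → ι → ℝ => (Matrix.of A)⁻¹ i j) A := by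
  have hd : ContDiffAt ℝ ∞ (fun A : ι → ι → ℝ => (Matrix.of A).det) A :=
    contDiffAt_det fun k l => (contDiff_apply_apply ℝ ℝ k l).contDiffAt
  have ha : ContDiffAt ℝ ∞ (fun A : ι → ι → ℝ => (Matrix.of A).adjugate i j) A := by
    simp only [Matrix.adjugate_apply]
    refine contDiffAt_det fun k l => ?_
    by_cases h : k = j
    · subst h
      simpa using contDiffAt_const
    · simpa [Matrix.updateRow_ne h] using (contDiff_apply_apply ℝ ℝ k l).contDiffAt
  simp only [Matrix.inv_def, Ring.inverse_eq_inv', Matrix.smul_apply, smul_eq_mul]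
  exact (hd.inv hA).mul ha

end MatrixInverse

/-! ### Smoothness of vector fields tested by the metric. -/

section Smoothness

variable {E : Type*} [NormedAddCommGroup E] [NormedSpace ℝ E]
  {H : Type*} [TopologicalSpace H] {I : ModelWithCorners ℝ E H}
  {M : Type*} [TopologicalSpace M] [ChartedSpace H M] [IsManifold I ∞ M]

/-- A basis of the model space defines a basis of the tangent spaces at the points of a chart. -/
def chartBasis {ι : Type*} (b : Module.Basis ι ℝ E) {x y : M} (hy : y ∈ (chartAt H x).source) :
    Module.Basis ι ℝ (TangentSpace I y) :=
  (trivializationAt E (TangentSpace I) x).basisAt b (by simpa using hy)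

theorem chartBasis_apply {ι : Type*} (b : Module.Basis ι ℝ E) {x y : M}
    (hy : y ∈ (chartAt H x).source) (i : ι) :
    chartBasis (I := I) b hy i = chartField I x (b i) y := by
  rw [chartField_eq_symmL I _ hy]
  refine Eq.trans ?_ (Trivialization.symmL_apply (R := ℝ) _ (by simpa using hy) _).symm
  simp [chartBasis, Trivialization.basisAt]

variable [RiemannianBundle (fun x : M => TangentSpace I x)]
  [IsContMDiffRiemannianBundle I ∞ E (fun x : M => TangentSpace I x)]

/-- The component `g(v, w)` of the metric with respect to vectors that are constant in the chart
at `x`. -/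
def metricComponent (I : ModelWithCorners ℝ E H) [IsManifold I ∞ M]
    [RiemannianBundle (fun x : M => TangentSpace I x)] (x : M) (v w : E) (y : M) : ℝ :=
  inner ℝ (chartField I x v y) (chartField I x w y)

theorem contMDiffOn_metricComponent (x : M) (v w : E) :
    CMDiff[(chartAt H x).source] ∞ (metricComponent I x v w) :=
  ContMDiffOn.inner_bundle (F := E) (E := fun x : M => TangentSpace I x)
    (contMDiffOn_chartField I x v) (contMDiffOn_chartField I x w)

theorem metricComponent_comm (x : M) (v w : E) :
    metricComponent I x v w = metricComponent I x w v :=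
  funext fun _ => real_inner_comm _ _

/-- The coefficients of `σ` in the chart frame are the inverse Gram matrix applied to the inner
products with the frame. This is how covariant derivatives, which are known only through their inner
products, are seen to be smooth. -/
theorem contMDiffAt_of_inner_chartField [FiniteDimensional ℝ E] {x y : M}
    {σ : Π y : M, TangentSpace I y} (hy : y ∈ (chartAt H x).source)
    (hσ : ∀ u : E, CMDiffAt ∞ (fun z => (inner ℝ (σ z) (chartField I x u z) : ℝ)) y) :
    CMDiffAt ∞ (T% σ) y := by
  have hsrc := (chartAt H x).open_source.mem_nhds hy
  let b := Module.finBasis ℝ E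
  let G : M → Fin (Module.finrank ℝ E) → Fin (Module.finrank ℝ E) → ℝ :=
    fun z i j => metricComponent I x (b i) (b j) z
  have hG (z : M) (hz : z ∈ (chartAt H x).source) : (Matrix.of (G z)).det ≠ 0 := by
    have h := Matrix.posDef_gram_of_linearIndependent (𝕜 := ℝ)
      (chartBasis (I := I) b hz).linearIndependent
    have h' : Matrix.gram ℝ (chartBasis (I := I) b hz) = Matrix.of (G z) := by
      ext i j
      simp [G, metricComponent, Matrix.gram, chartBasis_apply]
    rw [← h']
    exact h.det_pos.ne'
  have hGsm : ContMDiffAt I 𝓘(ℝ, Fin (Module.finrank ℝ E) → Fin (Module.finrank ℝ E) → ℝ) ∞ G y := by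
    simp only [contMDiffAt_pi_space]
    exact fun i j => (contMDiffOn_metricComponent x (b i) (b j)).contMDiffAt hsrc
  -- Pairing the expansion of `σ z` with the frame gives a linear system with the Gram matrix, which
  -- is invertible by positive definiteness.
  have hcoef (z : M) (hz : z ∈ (chartAt H x).source) (i) :
      (chartBasis (I := I) b hz).repr (σ z) i =
        ∑ j, (Matrix.of (G z))⁻¹ i j * inner ℝ (σ z) (chartField I x (b j) z) := by
    have h : Matrix.of (G z) *ᵥ (chartBasis (I := I) b hz).repr (σ z) =
        fun j => (inner ℝ (σ z) (chartField I x (b j) z) : ℝ) := by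
      funext j
      conv_rhs => rw [← (chartBasis (I := I) b hz).sum_repr (σ z)]
      simp [Matrix.mulVec, dotProduct, G, metricComponent, sum_inner, inner_smul_left,
        chartBasis_apply, mul_comm, real_inner_comm]
    have h2 := congrFun (congrArg ((Matrix.of (G z))⁻¹ *ᵥ ·) h) i
    simp only [Matrix.mulVec_mulVec, Matrix.nonsing_inv_mul _ (hG z hz).isUnit,
      Matrix.one_mulVec] at h2
    exact h2
  have key : CMDiffAt ∞ (T% fun z => ∑ i, (∑ j, (Matrix.of (G z))⁻¹ i j *
      inner ℝ (σ z) (chartField I x (b j) z)) • chartField I x (b i) z) y := by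
    refine ContMDiffAt.sum_section fun i _ => ContMDiffAt.smul_section ?_
      ((contMDiffOn_chartField I x (b i)).contMDiffAt hsrc)
    refine ContMDiffAt.sum fun j _ => ContMDiffAt.mul ?_ (hσ _)
    exact (contDiffAt_inv_apply (hG y hy) i j).contMDiffAt.comp y hGsm
  refine key.congr_of_eventuallyEq ?_
  filter_upwards [hsrc] with z hz
  congr 1
  conv_lhs => rw [← (chartBasis (I := I) b hz).sum_repr (σ z)]
  simp only [hcoef, chartBasis_apply]

end Smoothness

/-! ### Christoffel symbols and curvature of the two connections. -/

section Connection

variable {E : Type*} [NormedAddCommGroup E] [NormedSpace ℝ E]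
  {H : Type*} [TopologicalSpace H] (I : ModelWithCorners ℝ E H)
  {M : Type*} [TopologicalSpace M] [ChartedSpace H M] [IsManifold I ∞ M]
  [FiniteDimensional ℝ E] [RiemannianBundle (fun x : M => TangentSpace I x)]
  [IsContMDiffRiemannianBundle I ∞ E (fun x : M => TangentSpace I x)] [CompleteSpace E]

theorem connectionPlus_apply (B : Π x : M, TangentSpace I x [⋀^Fin 3]→L[ℝ] ℝ)
    (Y : Π x : M, TangentSpace I x) (x : M) (v : TangentSpace I x) :
    connectionPlus I B Y x v = leviCivita I Y x v + threeFormEnd (B x) v (Y x) := rfl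

/-- Every formula proved for `∇` and all `B` then holds for `∇₋` with `-B` in place of `B`. -/
theorem connectionMinus_eq_connectionPlus_neg (B : Π x : M, TangentSpace I x [⋀^Fin 3]→L[ℝ] ℝ) :
    connectionMinus I B = connectionPlus I fun x => -B x := by
  unfold connectionMinus connectionPlus
  congr 1
  funext x
  ext Y X
  refine ext_inner_right ℝ fun Z => ?_
  have h : endOneForm I (fun x => -B x) x Y X = threeFormEnd (-B x) X Y := rfl
  rw [h, inner_threeFormEnd]
  have h2 : (-endOneForm I B x) Y X = -threeFormEnd (B x) X Y := rfl
  rw [h2, inner_neg_left, inner_threeFormEnd]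
  exact (mul_neg _ _).symm

theorem inner_threeFormEnd_swap {V : Type*} [NormedAddCommGroup V] [InnerProductSpace ℝ V]
    [FiniteDimensional ℝ V] (A : V [⋀^Fin 3]→L[ℝ] ℝ) (X Y Z : V) :
    inner ℝ (threeFormEnd A X Y) Z = -inner ℝ Y (threeFormEnd A X Z) := by
  rw [real_inner_comm _ Y, inner_threeFormEnd, inner_threeFormEnd, threeForm_rotate A X Z Y,
    threeForm_swap A Z Y X, ← threeForm_rotate A X Y Z]
  ring

theorem threeFormEnd_swap {V : Type*} [NormedAddCommGroup V] [InnerProductSpace ℝ V]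
    [FiniteDimensional ℝ V] (A : V [⋀^Fin 3]→L[ℝ] ℝ) (X Y : V) :
    threeFormEnd A X Y = -threeFormEnd A Y X := by
  refine ext_inner_right ℝ fun Z => ?_
  rw [inner_neg_left, inner_threeFormEnd, inner_threeFormEnd, threeForm_swap]
  ring

theorem connectionPlus_metric (B : Π x : M, TangentSpace I x [⋀^Fin 3]→L[ℝ] ℝ)
    {X Y Z : Π x : M, TangentSpace I x} {x : M}
    (hX : MDiffAt (T% X) x) (hY : MDiffAt (T% Y) x) (hZ : MDiffAt (T% Z) x) :
    d% (fun y => (inner ℝ (Y y) (Z y) : ℝ)) x (X x) =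
      inner ℝ (connectionPlus I B Y x (X x)) (Z x)
        + inner ℝ (Y x) (connectionPlus I B Z x (X x)) := by
  rw [leviCivita_metric I hX hY hZ, connectionPlus_apply, connectionPlus_apply, inner_add_left,
    inner_add_right, inner_threeFormEnd_swap]
  ring

/-- The Christoffel symbol `g(∇_v w, u)` of the connection `∇^{LC} + B_𝔬`, with respect to vectors
that are constant in the chart at `x`. -/
def christoffel (B : Π x : M, TangentSpace I x [⋀^Fin 3]→L[ℝ] ℝ) (x : M) (v w u : E) (y : M) : ℝ :=
  1 / 2 * (d% (metricComponent I x w u) y (chartField I x v y)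
    + d% (metricComponent I x v u) y (chartField I x w y)
    - d% (metricComponent I x v w) y (chartField I x u y)) + 2 * chartComponent B x v w u y

theorem mdifferentiableAt_chartField {x y : M} (v : E) (hy : y ∈ (chartAt H x).source) :
    MDiffAt (T% (chartField I x v)) y :=
  ((contMDiffOn_chartField I x v).contMDiffAt
    ((chartAt H x).open_source.mem_nhds hy)).mdifferentiableAt (by simp)

/-- The bracket terms of the Koszul formula vanish on chart fields. -/
theorem inner_connectionPlus_chartField (B : Π x : M, TangentSpace I x [⋀^Fin 3]→L[ℝ] ℝ)
    {x y : M} (v w u : E) (hy : y ∈ (chartAt H x).source) :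
    inner ℝ (connectionPlus I B (chartField I x w) y (chartField I x v y)) (chartField I x u y) =
      christoffel I B x v w u y := by
  have h := inner_leviCivitaFun I (mdifferentiableAt_chartField I v hy)
    (mdifferentiableAt_chartField I w hy) (mdifferentiableAt_chartField I u hy)
  rw [connectionPlus_apply, inner_add_left, inner_threeFormEnd]
  refine (congrArg (· + _) h).trans ?_
  simp only [koszul, mlieBracket_chartField I _ _ hy, inner_zero_left, add_zero, sub_zero]
  rfl

theorem contMDiffOn_christoffel [I.Boundaryless] {B : Π x : M, TangentSpace I x [⋀^Fin 3]→L[ℝ] ℝ}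
    (hB : IsSmoothForm I B) (x : M) (v w u : E) :
    CMDiff[(chartAt H x).source] ∞ (christoffel I B x v w u) := by
  have h (u v w : E) := contMDiffOn_mvfderiv_chartField u
    (contMDiffOn_metricComponent (I := I) x v w)
  exact (contMDiffOn_const.mul (((h v w u).add (h w v u)).sub (h u v w))).add
    (contMDiffOn_const.mul (contMDiffOn_chartComponent hB x v w u))

/-- A second covariant derivative is taken by applying the metric property to `∇_v w`, which
requires this field to be differentiable. -/
theorem mdifferentiableAt_connectionPlus_chartField [I.Boundaryless]
    {B : Π x : M, TangentSpace I x [⋀^Fin 3]→L[ℝ] ℝ} (hB : IsSmoothForm I B) (x : M) (v w : E) :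
    MDiffAt (T% fun y => connectionPlus I B (chartField I x w) y (chartField I x v y)) x := by
  refine (contMDiffAt_of_inner_chartField (mem_chart_source H x) fun u => ?_).mdifferentiableAt
    (by simp)
  refine ((contMDiffOn_christoffel I hB x v w u).contMDiffAt
    (chart_source_mem_nhds H x)).congr_of_eventuallyEq ?_
  filter_upwards [chart_source_mem_nhds H x] with y hy
  exact inner_connectionPlus_chartField I B v w u hy

/-- The metric property moves the outer derivative: `g(∇_u ∇_v w, z) = u g(∇_v w, z) - g(∇_v w, ∇_u
z)`. Antisymmetrize in `u`, `v`; the term with `[u, v]` is zero. -/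
theorem inner_curvatureField_chartField [I.Boundaryless]
    {B : Π x : M, TangentSpace I x [⋀^Fin 3]→L[ℝ] ℝ} (hB : IsSmoothForm I B) (x : M)
    (u v w z : E) :
    inner ℝ (curvatureField I (connectionPlus I B) (chartField I x u) (chartField I x v)
        (chartField I x w) x) (chartField I x z x) =
      d% (christoffel I B x v w z) x (chartField I x u x)
      - d% (christoffel I B x u w z) x (chartField I x v x)
      - inner ℝ (connectionPlus I B (chartField I x w) x (chartField I x v x))
          (connectionPlus I B (chartField I x z) x (chartField I x u x))
      + inner ℝ (connectionPlus I B (chartField I x w) x (chartField I x u x))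
          (connectionPlus I B (chartField I x z) x (chartField I x v x)) := by
  have hx := mem_chart_source H x
  have h (u v : E) : inner ℝ (connectionPlus I B
        (fun y => connectionPlus I B (chartField I x w) y (chartField I x v y)) x
          (chartField I x u x)) (chartField I x z x) =
      d% (christoffel I B x v w z) x (chartField I x u x)
      - inner ℝ (connectionPlus I B (chartField I x w) x (chartField I x v x))
          (connectionPlus I B (chartField I x z) x (chartField I x u x)) := by
    have h1 := connectionPlus_metric I B (mdifferentiableAt_chartField I u hx)
      (mdifferentiableAt_connectionPlus_chartField I hB x v w) (mdifferentiableAt_chartField I z hx)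
    have h2 : (fun y => (inner ℝ (connectionPlus I B (chartField I x w) y (chartField I x v y))
        (chartField I x z y) : ℝ)) =ᶠ[𝓝 x] christoffel I B x v w z := by
      filter_upwards [chart_source_mem_nhds H x] with y hy
      exact inner_connectionPlus_chartField I B v w z hy
    rw [mvfderiv_congr_of_eventuallyEq h2] at h1
    rw [h1]
    ring
  simp only [curvatureField, mlieBracket_chartField I _ _ hx, map_zero, sub_zero, inner_sub_left]
  rw [h, h]
  ring

/-- Exchanging the two fields costs nothing for the torsion-free part, because they commute, and
changes the sign of `B_𝔬`. -/
theorem connectionPlus_chartField_swap (B : Π x : M, TangentSpace I x [⋀^Fin 3]→L[ℝ] ℝ) (x : M)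
    (v w : E) :
    connectionPlus I B (chartField I x w) x (chartField I x v x) =
      connectionPlus I (fun x => -B x) (chartField I x v) x (chartField I x w x) := by
  have hx := mem_chart_source H x
  have h := (CovariantDerivative.torsion_eq_zero_iff (cov := leviCivita I (M := M))).1
    (torsion_leviCivita I) (mdifferentiableAt_chartField I v hx)
    (mdifferentiableAt_chartField I w hx)
  rw [mlieBracket_chartField I _ _ hx, sub_eq_zero] at h
  rw [connectionPlus_apply, connectionPlus_apply, h, threeFormEnd_swap]
  congr 1
  refine ext_inner_right ℝ fun Z => ?_
  rw [inner_neg_left, inner_threeFormEnd, inner_threeFormEnd]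
  exact (mul_neg _ _).symm

theorem mvfderiv_half_mul_add_two_mul {x : M} {a b c d : M → ℝ} (ha : MDiffAt a x)
    (hb : MDiffAt b x) (hc : MDiffAt c x) (hd : MDiffAt d x) (v : TangentSpace I x) :
    d% (fun y => 1 / 2 * (a y + b y - c y) + 2 * d y) x v =
      1 / 2 * (d% a x v + d% b x v - d% c x v) + 2 * d% d x v := by
  have hk (r : ℝ) : MDiffAt (fun _ : M => r) x := mdifferentiableAt_const
  have h : (fun y => 1 / 2 * (a y + b y - c y) + 2 * d y) =
      (fun _ => 1 / 2) * (a + b - c) + (fun _ => 2) * d := rfl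
  rw [h, mvfderiv_add ((hk _).mul ((ha.add hb).sub hc)) ((hk _).mul hd),
    mvfderiv_mul (hk _) ((ha.add hb).sub hc), mvfderiv_mul (hk _) hd,
    mvfderiv_sub (ha.add hb) hc, mvfderiv_add ha hb, mvfderiv_const, mvfderiv_const]
  simp

theorem mvfderiv_christoffel [I.Boundaryless]
    {B : Π x : M, TangentSpace I x [⋀^Fin 3]→L[ℝ] ℝ} (hB : IsSmoothForm I B) (x : M)
    (t v w u : E) :
    d% (christoffel I B x v w u) x (chartField I x t x) =
      1 / 2 * (d% (fun y => d% (metricComponent I x w u) y (chartField I x v y)) x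
          (chartField I x t x)
        + d% (fun y => d% (metricComponent I x v u) y (chartField I x w y)) x (chartField I x t x)
        - d% (fun y => d% (metricComponent I x v w) y (chartField I x u y)) x (chartField I x t x))
      + 2 * d% (chartComponent B x v w u) x (chartField I x t x) := by
  have hx := mem_chart_source H x
  have h (u v w : E) := mdifferentiableAt_of_contMDiffOn (contMDiffOn_mvfderiv_chartField u
    (contMDiffOn_metricComponent (I := I) x v w)) hx
  have hb := mdifferentiableAt_of_contMDiffOn (contMDiffOn_chartComponent hB x v w u) hx
  exact mvfderiv_half_mul_add_two_mul I (h v w u) (h w v u) (h u v w) hb _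

/-- The heart of the proof: both curvatures are expanded in the chart, and their quadratic terms,
second derivatives of `g` and first derivatives of `B` are compared separately. -/
theorem transpose_curvatureField_chartField [I.Boundaryless]
    {B : Π x : M, TangentSpace I x [⋀^Fin 3]→L[ℝ] ℝ} (hB : IsSmoothForm I B) (x : M)
    (u v w z : E) :
    inner ℝ (curvatureField I (connectionPlus I B) (chartField I x w) (chartField I x z)
        (chartField I x u) x) (chartField I x v x) =
      inner ℝ (curvatureField I (connectionMinus I B) (chartField I x u) (chartField I x v)
        (chartField I x w) x) (chartField I x z x)
      + 2 * mextDeriv I B x ![chartField I x u x, chartField I x v x, chartField I x w x,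
          chartField I x z x] := by
  rw [connectionMinus_eq_connectionPlus_neg, inner_curvatureField_chartField I hB,
    inner_curvatureField_chartField I (isSmoothForm_neg hB), mextDeriv_chartField hB]
  -- The swap writes the quadratic terms on the left through `∇₋`; they then agree with those on the
  -- right up to the symmetry of `g`.
  simp only [mvfderiv_christoffel I hB, mvfderiv_christoffel I (isSmoothForm_neg hB),
    connectionPlus_chartField_swap I B x, chartComponent_neg, mvfderiv_neg]
  have hD (t u v w : E) := mvfderiv_chartField_comm t u
    (contMDiffOn_metricComponent (I := I) x v w)
  -- Of the second derivatives of `g`, these four mixed ones occur on both sides, with the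
  -- derivatives in opposite orders. The arguments of `g` are put in one order so that equal terms
  -- become identical.
  have h1 := hD w u z v
  have h2 := hD w v z u
  have h3 := hD z u w v
  have h4 := hD z v w u
  rw [metricComponent_comm x z v] at h1
  rw [metricComponent_comm x z u] at h2
  rw [metricComponent_comm x w v] at h3
  rw [metricComponent_comm x w u] at h4
  rw [metricComponent_comm x z v, metricComponent_comm x z u, metricComponent_comm x w v,
    metricComponent_comm x w u, chartComponent_rotate B x z u v, chartComponent_rotate B x w u v,
    real_inner_comm (connectionPlus I (fun x => -B x) (chartField I x z) x (chartField I x u x))]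
  simp only [neg_apply]
  -- The two added instances cancel the second derivatives of `g(u, v)` on the left and of `g(w, z)`
  -- on the right.
  linarith [hD w z u v, hD u v w z]

end Connection

/-! ### From chart fields to the curvature tensor. -/

section Curvature

variable {E : Type*} [NormedAddCommGroup E] [NormedSpace ℝ E]
  {H : Type*} [TopologicalSpace H] (I : ModelWithCorners ℝ E H)
  {M : Type*} [TopologicalSpace M] [ChartedSpace H M] [IsManifold I ∞ M]
  [FiniteDimensional ℝ E] [RiemannianBundle (fun x : M => TangentSpace I x)]
  [IsContMDiffRiemannianBundle I ∞ E (fun x : M => TangentSpace I x)] [CompleteSpace E]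

theorem curvature_apply_basis (cov : CovariantDerivative I E (TangentSpace I : M → Type _)) (x : M)
    (i j k : Fin (Module.finrank ℝ (TangentSpace I x))) :
    letI b := Module.finBasis ℝ (TangentSpace I x)
    curvature I cov x (b i) (b j) (b k) = curvatureField I cov (extend E (b i)) (extend E (b j))
      (extend E (b k)) x := by
  simp only [curvature, Module.Basis.constr_basis]

theorem transpose_curvatureField_extend [I.Boundaryless]
    {B : Π x : M, TangentSpace I x [⋀^Fin 3]→L[ℝ] ℝ} (hB : IsSmoothForm I B) {x : M}
    (u v w z : TangentSpace I x) :
    inner ℝ (curvatureField I (connectionPlus I B) (extend E w) (extend E z) (extend E u) x) v =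
      inner ℝ (curvatureField I (connectionMinus I B) (extend E u) (extend E v) (extend E w) x) z
      + 2 * mextDeriv I B x ![u, v, w, z] := by
  have h : _ = _ + 2 * mextDeriv I B x ![extend E u x, extend E v x, extend E w x, extend E z x] :=
    transpose_curvatureField_chartField I hB x u v w z
  rw [extend_apply_self, extend_apply_self, extend_apply_self, extend_apply_self] at h
  refine Eq.trans ?_ (h.trans ?_)
  · exact congrArg (inner ℝ _) (chartField_self I x v).symm
  · exact congrArg (inner ℝ _ · + _) (chartField_self I x z)

/-- Both sides are multilinear, so all four arguments may be taken from the basis that defines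
`curvature`. There the tensor is the curvature of chart fields by definition, and its tensoriality
is not needed. -/
theorem transposeEnd_curvature [I.Boundaryless]
    {B : Π x : M, TangentSpace I x [⋀^Fin 3]→L[ℝ] ℝ} (hB : IsSmoothForm I B) (x : M) :
    transposeEnd (curvature I (connectionPlus I B) x) =
      curvature I (connectionMinus I B) x + fourFormEnd (mextDeriv I B x) := by
  let b := Module.finBasis ℝ (TangentSpace I x)
  refine b.ext fun i => b.ext fun j => b.ext fun k =>
    InnerProductSpace.ext_inner_right_basis b fun l => ?_
  rw [inner_transposeEnd]
  simp only [LinearMap.add_apply, inner_add_left, inner_fourFormEnd, b, curvature_apply_basis]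
  exact transpose_curvatureField_extend I hB _ _ _ _

end Curvature

/-! ### Scaling and grading of the genus form. -/

section AhatGrading

theorem map_evalNilpotent {R S : Type*} [Ring R] [Algebra ℂ R] [Ring S] [Algebra ℂ S]
    (φ : R →ₐ[ℂ] S) (n : ℕ) (f : PowerSeries ℂ) (z : R) :
    φ (evalNilpotent n f z) = evalNilpotent n f (φ z) := by
  simp [evalNilpotent]

/-- `det^{1/2}((Ω/2) / sinh(Ω/2))` for a matrix with entries in a commutative algebra, with the
power series truncated at degree `n`. -/
def ahatElement {R : Type*} [CommRing R] [Algebra ℂ R] {n : ℕ} (Ω : Matrix (Fin n) (Fin n) R) : R :=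
  evalNilpotent n sqrtSeries ((evalNilpotent n ahatSeries Ω).det - 1)

/-- Only finite sums, powers and a determinant occur, and algebra homomorphisms preserve these. It
is used for the inclusion of a subalgebra and for the evaluation of polynomials. -/
theorem map_ahatElement {R S : Type*} [CommRing R] [Algebra ℂ R] [CommRing S] [Algebra ℂ S]
    (φ : R →ₐ[ℂ] S) {n : ℕ} (Ω : Matrix (Fin n) (Fin n) R) :
    φ (ahatElement Ω) = ahatElement (φ.mapMatrix Ω) := by
  rw [ahatElement, map_evalNilpotent, map_sub, map_one, AlgHom.map_det, map_evalNilpotent,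
    ahatElement]

variable {V : Type*} [NormedAddCommGroup V] [InnerProductSpace ℝ V] {n : ℕ}

theorem exteriorPower_eq_bot (e : OrthonormalBasis (Fin n) ℝ V) {k : ℕ} (hk : n < k) :
    (⋀[ℂ]^k (V →ₗ[ℝ] ℂ)) = ⊥ := by
  have : FiniteDimensional ℝ V := e.toBasis.finiteDimensional_of_finite
  have h : Module.finrank ℂ (V →ₗ[ℝ] ℂ) = n := by
    rw [Module.finrank_linearMap, Module.finrank_self, mul_one,
      Module.finrank_eq_card_basis e.toBasis, Fintype.card_fin]
  rw [← Submodule.finrank_eq_zero, exteriorPower.finrank_eq, h, Nat.choose_eq_zero_of_lt hk]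

theorem twoFormElement_mem_exteriorPower (e : OrthonormalBasis (Fin n) ℝ V) (η : V → V → ℝ) :
    (twoFormElement e η : ComplexForms V) ∈ ⋀[ℂ]^2 (V →ₗ[ℝ] ℂ) := by
  change ∑ i, ∑ j ∈ Finset.Ioi i, (η (e i) (e j) : ℂ) • (ExteriorAlgebra.ι ℂ (dualCovector e i) *
    ExteriorAlgebra.ι ℂ (dualCovector e j)) ∈ _
  refine Submodule.sum_mem _ fun i _ => Submodule.sum_mem _ fun j _ => Submodule.smul_mem _ _ ?_
  have h : (⋀[ℂ]^2 (V →ₗ[ℝ] ℂ)) = (ExteriorAlgebra.ι ℂ).range * (ExteriorAlgebra.ι ℂ).range :=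
    pow_two _
  rw [h]
  exact Submodule.mul_mem_mul (LinearMap.mem_range_self _ _) (LinearMap.mem_range_self _ _)

variable (V) in
/-- The polynomials whose `j`-th coefficient is a form of degree `2 * j`. -/
def evenGradedPolynomials : Subalgebra ℂ (Polynomial (CentralForms V)) where
  carrier := {p | ∀ j, (p.coeff j : ComplexForms V) ∈ ⋀[ℂ]^(2 * j) (V →ₗ[ℝ] ℂ)}
  mul_mem' {p q} hp hq j := by
    rw [Polynomial.coeff_mul, AddSubmonoidClass.coe_finsetSum]
    refine Submodule.sum_mem _ fun x hx => ?_
    rw [← Finset.HasAntidiagonal.mem_antidiagonal.1 hx, mul_add]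
    exact SetLike.mul_mem_graded (hp x.1) (hq x.2)
  add_mem' {p q} hp hq j := by
    rw [Polynomial.coeff_add]
    exact Submodule.add_mem _ (hp j) (hq j)
  algebraMap_mem' r j := by
    rw [Polynomial.algebraMap_apply, Polynomial.coeff_C]
    split_ifs with h
    · subst h
      exact SetLike.algebraMap_mem_graded (fun i : ℕ => ⋀[ℂ]^i (V →ₗ[ℝ] ℂ)) r
    · exact Submodule.zero_mem _

/-- The matrix `X • Ω`, with `X` a formal variable. -/
def formalMultiple (Ω : Matrix (Fin n) (Fin n) (CentralForms V)) :
    Matrix (Fin n) (Fin n) (Polynomial (CentralForms V)) :=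
  Ω.map fun η => Polynomial.monomial 1 η

/-- The entries of `X • Ω` lie in the subalgebra `evenGradedPolynomials V`, so the whole
construction can be carried out inside it. -/
theorem ahatElement_formalMultiple_mem {Ω : Matrix (Fin n) (Fin n) (CentralForms V)}
    (hΩ : ∀ a b, (Ω a b : ComplexForms V) ∈ ⋀[ℂ]^2 (V →ₗ[ℝ] ℂ)) :
    ahatElement (formalMultiple Ω) ∈ evenGradedPolynomials V := by
  have h (a b : Fin n) : formalMultiple Ω a b ∈ evenGradedPolynomials V := by
    intro j
    rw [formalMultiple, Matrix.map_apply, Polynomial.coeff_monomial]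
    split_ifs with hj
    · subst hj
      exact hΩ a b
    · exact Submodule.zero_mem _
  let Ω' : Matrix (Fin n) (Fin n) (evenGradedPolynomials V) := fun a b => ⟨_, h a b⟩
  have h2 : formalMultiple Ω = (evenGradedPolynomials V).val.mapMatrix Ω' := rfl
  have h3 := map_ahatElement (evenGradedPolynomials V).val Ω'
  rw [h2]
  exact (congrArg (· ∈ evenGradedPolynomials V) h3).mp (ahatElement Ω').2

/-- Evaluation at `X = t` is an algebra homomorphism that sends `X • Ω` to `t • Ω`. The coefficients
do not depend on `t`. -/
theorem ahatForm_smul (e : OrthonormalBasis (Fin n) ℝ V)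
    {Ω : Matrix (Fin n) (Fin n) (CentralForms V)}
    (hΩ : ∀ a b, (Ω a b : ComplexForms V) ∈ ⋀[ℂ]^2 (V →ₗ[ℝ] ℂ)) (t : ℂ) :
    ahatForm (t • Ω) = ∑ j ∈ Finset.range (n + 1),
      t ^ j • ((ahatElement (formalMultiple Ω)).coeff j : ComplexForms V) := by
  let φ : Polynomial (CentralForms V) →ₐ[ℂ] CentralForms V :=
    (Polynomial.aeval (algebraMap ℂ (CentralForms V) t)).restrictScalars ℂ
  have h1 : φ.mapMatrix (formalMultiple Ω) = t • Ω := by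
    ext a b
    simp [φ, formalMultiple, Algebra.smul_def, mul_comm]
  -- For `j > n` the coefficient has form degree `2j > n`, hence is zero.
  have hd : (ahatElement (formalMultiple Ω)).natDegree < n + 1 := by
    refine Nat.lt_succ_of_le (Polynomial.natDegree_le_iff_coeff_eq_zero.2 fun j hj => ?_)
    have hm := ahatElement_formalMultiple_mem hΩ j
    rw [exteriorPower_eq_bot e (by omega), Submodule.mem_bot] at hm
    exact Subtype.ext hm
  have h2 : ahatForm (t • Ω) = (ahatElement (t • Ω) : CentralForms V) := rfl
  rw [h2, ← h1, ← map_ahatElement]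
  simp only [φ, AlgHom.restrictScalars_apply, Polynomial.coe_aeval_eq_eval]
  rw [Polynomial.eval_eq_sum_range' hd, AddSubmonoidClass.coe_finsetSum]
  refine Finset.sum_congr rfl fun j _ => ?_
  rw [← map_pow, mul_comm, ← Algebra.smul_def]
  rfl

theorem formDegree_of_mem {k : ℕ} {α : ComplexForms V} (hα : α ∈ ⋀[ℂ]^k (V →ₗ[ℝ] ℂ)) :
    formDegree k α = α := by
  simp [formDegree, GradedRing.proj_apply, DirectSum.decompose_of_mem_same (fun i : ℕ => ⋀[ℂ]^i (V →ₗ[ℝ] ℂ)) hα]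

theorem formDegree_of_mem_ne {k l : ℕ} {α : ComplexForms V} (hα : α ∈ ⋀[ℂ]^l (V →ₗ[ℝ] ℂ))
    (h : l ≠ k) : formDegree k α = 0 := by
  simp [formDegree, GradedRing.proj_apply, DirectSum.decompose_of_mem_ne (fun i : ℕ => ⋀[ℂ]^i (V →ₗ[ℝ] ℂ)) hα h]

theorem mehlerForm_eq_sum_formDegree_chernWeilAhat (e : OrthonormalBasis (Fin n) ℝ V)
    (A : V →ₗ[ℝ] V →ₗ[ℝ] V →ₗ[ℝ] V) (t : ℂ) :
    mehlerForm e A t = ∑ j ∈ Finset.range (n + 1), (2 * Real.pi * Complex.I * t) ^ j •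
      formDegree (2 * j) (chernWeilAhat e A) := by
  have hΩ (a b : Fin n) : (formMatrix e A a b : ComplexForms V) ∈ ⋀[ℂ]^2 (V →ₗ[ℝ] ℂ) :=
    twoFormElement_mem_exteriorPower e _
  rw [mehlerForm, chernWeilAhat, ahatForm_smul e hΩ, ahatForm_smul e hΩ]
  refine Finset.sum_congr rfl fun j hj => ?_
  have hm (i : ℕ) (c : ℂ) : c • ((ahatElement (formalMultiple (formMatrix e A))).coeff i :
      ComplexForms V) ∈ ⋀[ℂ]^(2 * i) (V →ₗ[ℝ] ℂ) :=
    Submodule.smul_mem _ _ (ahatElement_formalMultiple_mem hΩ i)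
  -- The projection to degree `2j` selects the `j`-th coefficient of the Chern-Weil form, with the
  -- factor `(2πi)^{-j}` that cancels against `(2πit)^j` to leave `t^j`.
  rw [map_sum, Finset.sum_eq_single j
    (fun i _ hij => formDegree_of_mem_ne (hm i _) (by omega)) (fun h => absurd hj h),
    formDegree_of_mem (hm j _), smul_smul, ← mul_pow]
  congr 2
  field_simp [Complex.two_pi_I_ne_zero]

end AhatGrading

end SkewTorsion

end

/-! ### The theorem for manifolds modelled on Euclidean space. -/

theorem propositionp {n : ℕ} {M : Type*} [TopologicalSpace M]
    [ChartedSpace (EuclideanSpace ℝ (Fin n)) M] [IsManifold (𝓡 n) ∞ M]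
    [RiemannianBundle (fun x : M => TangentSpace (𝓡 n) x)]
    [IsContMDiffRiemannianBundle (𝓡 n) ∞ (EuclideanSpace ℝ (Fin n))
      (fun x : M => TangentSpace (𝓡 n) x)]
    (B : Π x : M, TangentSpace (𝓡 n) x [⋀^Fin 3]→L[ℝ] ℝ) (hB : IsSmoothForm (𝓡 n) B) :
    (∀ x : M, transposeEnd (curvature (𝓡 n) (connectionPlus (𝓡 n) B) x) =
      curvature (𝓡 n) (connectionMinus (𝓡 n) B) x + fourFormEnd (mextDeriv (𝓡 n) B x)) ∧
    ((∀ x : M, mextDeriv (𝓡 n) B x = 0) →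
      (∀ x : M, transposeEnd (curvature (𝓡 n) (connectionPlus (𝓡 n) B) x) =
        curvature (𝓡 n) (connectionMinus (𝓡 n) B) x) ∧
      ∀ (x : M) (e : OrthonormalBasis (Fin n) ℝ (TangentSpace (𝓡 n) x)) (t : ℂ),
        mehlerForm e (transposeEnd (curvature (𝓡 n) (connectionPlus (𝓡 n) B) x)) t =
          ∑ j ∈ Finset.range (n + 1), (2 * Real.pi * Complex.I * t) ^ j •
            formDegree (2 * j)
              (chernWeilAhat e (curvature (𝓡 n) (connectionMinus (𝓡 n) B) x))) := by
  have h := transposeEnd_curvature (𝓡 n) hB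
  have h0 (hd : ∀ x : M, mextDeriv (𝓡 n) B x = 0) (x : M) :
      transposeEnd (curvature (𝓡 n) (connectionPlus (𝓡 n) B) x) =
        curvature (𝓡 n) (connectionMinus (𝓡 n) B) x := by
    refine (h x).trans ?_
    rw [hd x]
    refine LinearMap.ext fun W => LinearMap.ext fun X => LinearMap.ext fun Y =>
      ext_inner_right ℝ fun Z => ?_
    simp only [LinearMap.add_apply, inner_add_left, inner_fourFormEnd]
    exact (congrArg (_ + ·) (mul_zero 2)).trans (add_zero _)
  refine ⟨h, fun hd => ⟨h0 hd, fun x e t => ?_⟩⟩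
  rw [h0 hd x]
  exact mehlerForm_eq_sum_formDegree_chernWeilAhat e _ t
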